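/- There are universal constants $C>0$ and $k\in\mathbb{N}$ such that the following holds. Let $d,m\ge 1$ be integers, $\delta\in(0,1)$, $\gamma>0$, and let $\mathcal{D}$ be a probability distribution over $\{\mathbf{x}\in\mathbb{R}^d:\|\mathbf{x}\|\le 1\}\times\{-1,+1\}$ for which there is a unit vector $\mathbf{w}_0\in\mathbb{R}^d$ with $\Pr_{(\mathbf{x},y)\sim\mathcal{D}}(y\,\mathbf{x}^\top\mathbf{w}_0\ge\gamma)=1$. Sample $(\mathbf{x}_1,y_1),\dots,(\mathbf{x}_m,y_m)$ i.i.d. from $\mathcal{D}$ and let $\hat L(\mathbf{w})=\frac1m\sum_{i=1}^m\exp(-y_i\mathbf{x}_i^\top\mathbf{w})$. Then with probability at least $1-\delta$ over the sample, gradient flow on $\hat L$ started at the origin, that is, the trajectory with $\mathbf{w}(0)=\mathbf{0}$ and $\frac{d}{dt}\mathbf{w}(t)=-\nabla\hat L(\mathbf{w}(t))$ for all $t\ge 0$, satisfies, simultaneously for all times $T>0$, \[ \Pr_{(\mathbf{x},y)\sim\mathcal{D}}\bigl(\mathrm{sign}(\mathbf{x}^\top\mathbf{w}(T))\ne y\bigr)\;\le\;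 C\Bigl(1+\max\{0,\log(\gamma^2m)\}+\log\tfrac1\delta\Bigr)^{k}\left(\frac{1}{\gamma^2T}+\frac{1}{\gamma^2m}\right), \] where $\mathrm{sign}(0)=0$. In other words, the error is $\tilde{\mathcal{O}}\bigl(\frac{1}{\gamma^2T}+\frac{1}{\gamma^2m}\bigr)$, where $\tilde{\mathcal{O}}$ hides universal constants and factors polylogarithmic in $\gamma^2m$ and $1/\delta$. -/

import Mathlib

open MeasureTheory Real

noncomputable section

/-- The empirical risk `w ↦ (1/m) ∑ ℓ(yᵢ ⟨xᵢ, w⟩)` of the labelled sample `S = ((xᵢ, yᵢ))ᵢ`. -/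
def empiricalRisk {d m : ℕ} (ℓ : ℝ → ℝ) (S : Fin m → EuclideanSpace ℝ (Fin d) × ℝ)
    (w : EuclideanSpace ℝ (Fin d)) : ℝ :=
  (1 / (m : ℝ)) * ∑ i, ℓ ((S i).2 * inner ℝ (S i).1 w)

/-- The exponential loss `z ↦ exp(-z)`. -/
def expLoss (z : ℝ) : ℝ := Real.exp (-z)

/-- `w` (on times `t ≥ 0`) is a gradient flow of `L` started at the origin: `w(0) = 0` and
`w'(t) = -∇L(w(t))` for all `t ≥ 0` (one-sided derivative at `t = 0`). -/
structure IsGradientFlow {E : Type*} [NormedAddCommGroup E] [InnerProductSpace ℝ E]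
    [CompleteSpace E] (L : E → ℝ) (w : ℝ → E) : Prop where
  init : w 0 = 0
  deriv : ∀ t : ℝ, 0 ≤ t → HasDerivWithinAt w (-gradient L (w t)) (Set.Ici 0) t

/-- The 0-1 generalization error `Pr_{(x,y) ∼ D}(sign ⟨x, w⟩ ≠ y)`. As `Real.sign 0 = 0`, points
with `⟨x, w⟩ = 0` count as errors. -/
def zeroOneError {d : ℕ} (D : Measure (EuclideanSpace ℝ (Fin d) × ℝ))
    (w : EuclideanSpace ℝ (Fin d)) : ℝ :=
  D.real {z | Real.sign (inner ℝ z.1 w) ≠ z.2}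

end

/-!
The proof combines two properties of gradient flow on the exponential loss with a PAC-Bayes margin
bound.

Since `log L` decreases at the rate `‖∇L‖² / L` and `‖∇L‖ ≥ γ L` on data with margin `γ`, the
trajectory satisfies `L(w T) ≤ exp (-γ ‖w T‖)` at all times
(`IsGradientFlow.risk_le_exp_neg_norm`). By convexity, comparison with `a • w₀` gives
`L(w T) ≤ exp (-a γ) + a² / (2 T)` (`IsGradientFlow.risk_le`).

For the generalization error, a linear predictor is perturbed by a standard Gaussian vector. The
centred Gaussian serves as prior, and the exponential moment of the discounted error minus the
empirical error is at most one, which gives a bound with the fast rate `1 / m`, simultaneous for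
all predictors (`integral_error_le_of_mem_pacGood`). The cost of a predictor `v` is `‖v‖² / 2`; the
perturbation at most halves its error, and it rarely spoils sample points whose margin exceeds
`√(2 log (γ² m))`. Together with Markov's inequality for the loss this is
`zeroOneError_le_of_mem_pacGood`.

Put `ℓ = log (γ² m)`. If `γ ‖w T‖ ≥ 2 ℓ`, then by the first property all but a fraction `1 / (γ² m)`
of the sample has normalized margin at least `γ / 2`, however large `T` is. If not, the norm is at
most `2 ℓ / γ`, and the second property with `a = ℓ / γ` bounds the fraction of points with margin
less than one. Thus no logarithm of `T`, of the dimension, or of `1 / γ` enters.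
-/

/-! ### The standard Gaussian measure through its density -/

section Gaussian

variable {E : Type*} [NormedAddCommGroup E] [InnerProductSpace ℝ E] [FiniteDimensional ℝ E]
  [MeasurableSpace E] [BorelSpace E]

/-- The density of the standard Gaussian measure on `E` with respect to `volume`. -/
noncomputable def gaussianDensity (E : Type*) [NormedAddCommGroup E] [InnerProductSpace ℝ E]
    [FiniteDimensional ℝ E] [MeasurableSpace E] [BorelSpace E] (x : E) : ENNReal :=
  ENNReal.ofReal ((∫ y : E, exp (-(1 / 2) * ‖y‖ ^ 2))⁻¹ * exp (-(1 / 2) * ‖x‖ ^ 2))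

/-- The standard Gaussian measure, defined by its density so that translating it amounts to the
translation invariance of `volume`. -/
noncomputable def gaussianMeasure (E : Type*) [NormedAddCommGroup E] [InnerProductSpace ℝ E]
    [FiniteDimensional ℝ E] [MeasurableSpace E] [BorelSpace E] : Measure E :=
  volume.withDensity (gaussianDensity E)

@[fun_prop]
lemma measurable_gaussianDensity : Measurable (gaussianDensity E) := by
  unfold gaussianDensity; fun_prop

lemma lintegral_gaussianMeasure (F : E → ENNReal) (hF : Measurable F) :
    ∫⁻ g, F g ∂gaussianMeasure E = ∫⁻ g, gaussianDensity E g * F g := by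
  rw [gaussianMeasure, lintegral_withDensity_eq_lintegral_mul _ measurable_gaussianDensity hF]
  rfl

instance isProbabilityMeasure_gaussianMeasure : IsProbabilityMeasure (gaussianMeasure E) := by
  have hpos : 0 < ∫ y : E, exp (-(1 / 2) * ‖y‖ ^ 2) := by
    rw [GaussianFourier.integral_rexp_neg_mul_sq_norm (by norm_num)]
    positivity
  -- a function with nonzero Bochner integral is integrable
  have hint : Integrable (fun y : E => exp (-(1 / 2) * ‖y‖ ^ 2)) := by
    by_contra h
    exact hpos.ne' (integral_undef h)
  constructor
  rw [← lintegral_one, lintegral_gaussianMeasure _ measurable_const]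
  simp only [mul_one, gaussianDensity]
  rw [← ofReal_integral_eq_lintegral_ofReal (hint.const_mul _)
    (Filter.Eventually.of_forall fun x => by positivity), integral_const_mul,
    inv_mul_cancel₀ hpos.ne', ENNReal.ofReal_one]

/-- The Cameron–Martin formula. -/
lemma lintegral_gaussianMeasure_add (F : E → ENNReal) (hF : Measurable F) (v : E) :
    ∫⁻ g, F (g + v) ∂gaussianMeasure E =
      ∫⁻ g, ENNReal.ofReal (exp (inner ℝ v g - ‖v‖ ^ 2 / 2)) * F g ∂gaussianMeasure E := by
  rw [lintegral_gaussianMeasure _ (by fun_prop), lintegral_gaussianMeasure _ (by fun_prop),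
    ← lintegral_add_right_eq_self (fun g => gaussianDensity E g *
      (ENNReal.ofReal (exp (inner ℝ v g - ‖v‖ ^ 2 / 2)) * F g)) v]
  congr 1 with g
  rw [← mul_assoc]
  congr 1
  unfold gaussianDensity
  rw [← ENNReal.ofReal_mul (by positivity), mul_assoc, ← exp_add]
  congr 3
  rw [norm_add_sq_real, inner_add_right, real_inner_self_eq_norm_sq, real_inner_comm]
  ring

lemma measurePreserving_neg_gaussianMeasure :
    MeasurePreserving (fun g : E => -g) (gaussianMeasure E) (gaussianMeasure E) := by
  refine ⟨measurable_neg, ?_⟩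
  ext s hs
  rw [Measure.map_apply measurable_neg hs, gaussianMeasure,
    withDensity_apply _ (measurable_neg hs), withDensity_apply _ hs,
    ← lintegral_indicator (measurable_neg hs), ← lintegral_indicator hs,
    ← lintegral_neg_eq_self (fun g => s.indicator (gaussianDensity E) g)]
  congr 1 with g
  simp only [Set.indicator, gaussianDensity, norm_neg]
  rfl

lemma lintegral_exp_inner_gaussianMeasure (v : E) :
    ∫⁻ g, ENNReal.ofReal (exp (inner ℝ v g)) ∂gaussianMeasure E =
      ENNReal.ofReal (exp (‖v‖ ^ 2 / 2)) := by
  have h := lintegral_gaussianMeasure_add (fun _ : E => ENNReal.ofReal (exp (‖v‖ ^ 2 / 2)))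
    measurable_const v
  simp only [lintegral_const, measure_univ, mul_one] at h
  rw [h]
  congr 1 with g
  rw [← ENNReal.ofReal_mul (by positivity), ← exp_add, sub_add_cancel]

/-- The Chernoff bound for the Gaussian tail in the direction `x`. -/
lemma gaussianMeasure_real_le_inner (x : E) (hx : ‖x‖ ≤ 1) {s : ℝ} (hs : 0 ≤ s) :
    (gaussianMeasure E).real {g | s ≤ inner ℝ x g} ≤ exp (-(s ^ 2 / 2)) := by
  have hsub : {g : E | s ≤ inner ℝ x g} ⊆
      {g | ENNReal.ofReal (exp (s ^ 2)) ≤ ENNReal.ofReal (exp (inner ℝ (s • x) g))} := by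
    intro g hg
    simp only [Set.mem_ofPred_eq] at hg ⊢
    refine ENNReal.ofReal_le_ofReal (exp_le_exp.2 ?_)
    rw [real_inner_smul_left]
    nlinarith
  have h := (mul_le_mul_right (measure_mono hsub) (ENNReal.ofReal (exp (s ^ 2)))).trans
    (mul_meas_ge_le_lintegral (μ := gaussianMeasure E)
      (f := fun g => ENNReal.ofReal (exp (inner ℝ (s • x) g))) (by fun_prop) _)
  rw [lintegral_exp_inner_gaussianMeasure] at h
  have h' := ENNReal.toReal_mono ENNReal.ofReal_ne_top h
  rw [ENNReal.toReal_mul, ENNReal.toReal_ofReal (by positivity),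
    ENNReal.toReal_ofReal (by positivity)] at h'
  have h2 : exp (‖s • x‖ ^ 2 / 2) ≤ exp (s ^ 2) * exp (-(s ^ 2 / 2)) := by
    rw [← exp_add]
    refine exp_le_exp.2 ?_
    rw [norm_smul, mul_pow, norm_eq_abs, sq_abs]
    nlinarith [sq_nonneg s, mul_le_mul_of_nonneg_left
      (pow_le_one₀ (n := 2) (norm_nonneg x) hx) (sq_nonneg s)]
  exact le_of_mul_le_mul_left (h'.trans h2) (exp_pos _)

lemma integrable_inner_gaussianMeasure (v : E) :
    Integrable (fun g => inner ℝ v g) (gaussianMeasure E) := by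
  have hexp : ∀ u : E, Integrable (fun g => exp (inner ℝ u g)) (gaussianMeasure E) := fun u =>
    ⟨by fun_prop, by
      rw [hasFiniteIntegral_iff_ofReal (Filter.Eventually.of_forall fun _ => by positivity),
        lintegral_exp_inner_gaussianMeasure]
      exact ENNReal.ofReal_lt_top⟩
  refine ((hexp v).add (hexp (-v))).mono' (by fun_prop) (Filter.Eventually.of_forall fun g => ?_)
  simp only [Pi.add_apply, inner_neg_left, norm_eq_abs]
  refine abs_le.2 ⟨?_, ?_⟩
  · linarith [add_one_le_exp (-inner ℝ v g), exp_pos (inner ℝ v g)]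
  · linarith [add_one_le_exp (inner ℝ v g), exp_pos (-inner ℝ v g)]

lemma integral_inner_gaussianMeasure (v : E) :
    ∫ g, inner ℝ v g ∂gaussianMeasure E = 0 := by
  have h := measurePreserving_neg_gaussianMeasure.integral_comp
    (Homeomorph.neg E).measurableEmbedding (fun g : E => (inner ℝ v g : ℝ))
  simp only [inner_neg_right, integral_neg] at h
  linarith

/-- A half-space through the origin has Gaussian measure at least one half. -/
lemma half_le_gaussianMeasure_inner_nonpos (x : E) :
    1 / 2 ≤ (gaussianMeasure E).real {g | inner ℝ x g ≤ 0} := by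
  have hm : MeasurableSet {g : E | inner ℝ x g ≤ 0} :=
    measurableSet_le (by fun_prop) measurable_const
  have h1 : (gaussianMeasure E).real {g | 0 ≤ inner ℝ x g} =
      (gaussianMeasure E).real {g | inner ℝ x g ≤ 0} := by
    have := measurePreserving_neg_gaussianMeasure.measureReal_preimage
      (hm.nullMeasurableSet (μ := gaussianMeasure E))
    simpa [Set.preimage] using this
  have h2 := measureReal_union_le (μ := gaussianMeasure E)
    {g : E | inner ℝ x g ≤ 0} {g | 0 ≤ inner ℝ x g}
  have h3 : {g : E | inner ℝ x g ≤ 0} ∪ {g | 0 ≤ inner ℝ x g} = Set.univ := by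
    ext g; simpa using le_total _ _
  rw [h3, probReal_univ, h1] at h2
  linarith

/-- The change of measure at the heart of PAC-Bayes: the Gaussian centred at `v` has relative
entropy `‖v‖² / 2` with respect to the centred one, and the Donsker–Varadhan inequality follows
from Jensen's inequality and the Cameron–Martin formula. -/
lemma integral_shift_le_of_lintegral_exp_le (f : E → ℝ) (hf : Measurable f) {b : ℝ}
    (hb : ∀ g, |f g| ≤ b) (v : E) {B : ℝ} (hB : 0 < B)
    (h : ∫⁻ g, ENNReal.ofReal (exp (f g)) ∂gaussianMeasure E ≤ ENNReal.ofReal B) :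
    ∫ g, f (g + v) ∂gaussianMeasure E ≤ ‖v‖ ^ 2 / 2 + log B := by
  set φ : E → ℝ := fun g => f (g + v) - inner ℝ v g - ‖v‖ ^ 2 / 2 with hφ
  have hfi : Integrable (fun g => f (g + v)) (gaussianMeasure E) :=
    Integrable.of_bound (hf.comp (measurable_add_const v)).aestronglyMeasurable b
      (Filter.Eventually.of_forall fun g => hb _)
  have hφi : Integrable φ (gaussianMeasure E) :=
    (hfi.sub (integrable_inner_gaussianMeasure v)).sub (integrable_const _)
  have hφint : ∫ g, φ g ∂gaussianMeasure E = ∫ g, f (g + v) ∂gaussianMeasure E - ‖v‖ ^ 2 / 2 := by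
    have h1 := integral_sub (hfi.sub (integrable_inner_gaussianMeasure v))
      (integrable_const (‖v‖ ^ 2 / 2))
    have h2 := integral_sub hfi (integrable_inner_gaussianMeasure v)
    simp only [Pi.sub_apply, integral_const, probReal_univ, one_smul] at h1 h2
    rw [h1, h2, integral_inner_gaussianMeasure, sub_zero]
  have hcm := lintegral_gaussianMeasure_add
    (fun g => ENNReal.ofReal (exp (f g - inner ℝ v g + ‖v‖ ^ 2 / 2))) (by fun_prop) v
  have hl : ∫⁻ g, ENNReal.ofReal (exp (φ g)) ∂gaussianMeasure E ≤ ENNReal.ofReal B := by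
    calc _ = _ := by
            refine lintegral_congr fun g => ?_
            rw [hφ]
            congr 2
            rw [inner_add_right, real_inner_self_eq_norm_sq]
            ring
      _ = _ := hcm
      _ = ∫⁻ g, ENNReal.ofReal (exp (f g)) ∂gaussianMeasure E := by
            refine lintegral_congr fun g => ?_
            rw [← ENNReal.ofReal_mul (by positivity), ← exp_add]
            congr 2
            ring
      _ ≤ _ := h
  have hei : Integrable (fun g => exp (φ g)) (gaussianMeasure E) :=
    ⟨by fun_prop, by
      rw [hasFiniteIntegral_iff_ofReal (Filter.Eventually.of_forall fun _ => by positivity)]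
      exact hl.trans_lt ENNReal.ofReal_lt_top⟩
  have hj := convexOn_exp.map_integral_le (μ := gaussianMeasure E) continuous_exp.continuousOn
    isClosed_univ (Filter.Eventually.of_forall fun _ => Set.mem_univ _) hφi hei
  have he : ∫ g, exp (φ g) ∂gaussianMeasure E ≤ B := by
    rw [← ofReal_integral_eq_lintegral_ofReal hei
      (Filter.Eventually.of_forall fun _ => by positivity)] at hl
    exact (ENNReal.ofReal_le_ofReal_iff hB.le).1 hl
  have := (le_log_iff_exp_le hB).2 (hj.trans he)
  linarith

end Gaussian

/-! ### A PAC-Bayes bound -/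

/-- The number of points of the sample `S` on which the hypothesis `h` errs, where `err` is the set
of pairs (hypothesis, point) that count as errors. -/
noncomputable def errorCount {H Z : Type*} (err : Set (H × Z)) {m : ℕ} (S : Fin m → Z)
    (h : H) : ℝ :=
  ∑ i, err.indicator (fun _ => (1 : ℝ)) (h, S i)

lemma indicator_prodMk_left {H Z : Type*} (err : Set (H × Z)) (h : H) (z : Z) :
    err.indicator (fun _ => (1 : ℝ)) (h, z) =
      {z | (h, z) ∈ err}.indicator (fun _ => (1 : ℝ)) z := by
  by_cases hz : (h, z) ∈ err <;> simp [hz]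

lemma errorCount_nonneg {H Z : Type*} {err : Set (H × Z)} {m : ℕ} (S : Fin m → Z) (h : H) :
    0 ≤ errorCount err S h :=
  Finset.sum_nonneg fun _ _ => Set.indicator_nonneg (fun _ _ => zero_le_one) _

lemma errorCount_le {H Z : Type*} {err : Set (H × Z)} {m : ℕ} (S : Fin m → Z) (h : H) :
    errorCount err S h ≤ m := by
  refine (Finset.sum_le_card_nsmul _ _ 1 fun i _ => ?_).trans (by simp)
  exact Set.indicator_le_self' (fun _ _ => zero_le_one) _

section PacBayes

variable {H Z : Type*} [MeasurableSpace H] [MeasurableSpace Z]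

/-- The exponent of the PAC-Bayes bound: `m` times the population error, discounted by the factor
`1 - e⁻¹`, minus the number of errors on the sample. -/
noncomputable def pacExponent (err : Set (H × Z)) (D : Measure Z) {m : ℕ} (S : Fin m → Z) (h : H) :
    ℝ :=
  m * ((1 - exp (-1)) * D.real {z | (h, z) ∈ err}) - errorCount err S h

/-- The samples for which the prior expectation of the exponential of `pacExponent` is at most
`1 / δ`. -/
def pacGood (err : Set (H × Z)) (D : Measure Z) (P : Measure H) (m : ℕ) (δ : ℝ) :
    Set (Fin m → Z) :=
  {S | ∫⁻ h, ENNReal.ofReal (exp (pacExponent err D S h)) ∂P ≤ ENNReal.ofReal (1 / δ)}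

variable {err : Set (H × Z)} {D : Measure Z} [IsProbabilityMeasure D]
  {P : Measure H} [IsProbabilityMeasure P] {m : ℕ}

lemma measurable_errorCount (herr : MeasurableSet err) :
    Measurable (fun q : (Fin m → Z) × H => errorCount err q.1 q.2) := by
  unfold errorCount
  refine Finset.measurable_sum _ fun i _ => ?_
  exact (measurable_const.indicator herr).comp (by fun_prop : Measurable
    (fun q : (Fin m → Z) × H => (q.2, q.1 i)))

lemma measurable_real_section (herr : MeasurableSet err) :
    Measurable (fun h : H => D.real {z | (h, z) ∈ err}) :=
  (measurable_measure_prodMk_left herr).ennreal_toReal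

lemma measurable_pacExponent (herr : MeasurableSet err) :
    Measurable (fun q : (Fin m → Z) × H => pacExponent err D q.1 q.2) := by
  unfold pacExponent
  exact ((((measurable_real_section herr).comp measurable_snd).const_mul _).const_mul _).sub
    (measurable_errorCount herr)

lemma exp_neg_one_lt_one : exp (-1) < 1 := by
  rw [exp_lt_one_iff]; norm_num

omit [MeasurableSpace H] in
lemma abs_pacExponent_le (S : Fin m → Z) (h : H) : |pacExponent err D S h| ≤ m := by
  have h1 := errorCount_nonneg (err := err) S h
  have h2 := errorCount_le (err := err) S h
  have h3 : D.real {z | (h, z) ∈ err} ≤ 1 := measureReal_le_one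
  have h4 : 0 ≤ D.real {z | (h, z) ∈ err} := measureReal_nonneg
  have h5 := exp_pos (-1)
  have h6 : (1 - exp (-1)) * D.real {z | (h, z) ∈ err} ≤ 1 :=
    mul_le_one₀ (by linarith) h4 h3
  have h7 : 0 ≤ (1 - exp (-1)) * D.real {z | (h, z) ∈ err} :=
    mul_nonneg (by linarith [exp_neg_one_lt_one]) h4
  have hm : (0 : ℝ) ≤ m := Nat.cast_nonneg m
  unfold pacExponent
  rw [abs_le]
  constructor <;> nlinarith

/-- The Laplace transform of a Bernoulli variable of mean `p` at `-1` is
`1 - (1 - e⁻¹) p ≤ exp (-(1 - e⁻¹) p)`. -/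
lemma integral_exp_neg_indicator_le {s : Set Z} (hs : MeasurableSet s) :
    ∫ z, exp (-(s.indicator (fun _ => (1 : ℝ)) z)) ∂D ≤ exp (-((1 - exp (-1)) * D.real s)) := by
  have hpoint : ∀ z : Z, exp (-(s.indicator (fun _ => (1 : ℝ)) z)) =
      1 - (1 - exp (-1)) * s.indicator (fun _ => (1 : ℝ)) z := by
    intro z
    by_cases hz : z ∈ s <;> simp [hz]
  have hind : Integrable (s.indicator (fun _ => (1 : ℝ))) D :=
    (integrable_const _).indicator hs
  have hone : ∫ z, (1 - (1 - exp (-1)) * s.indicator (fun _ => (1 : ℝ)) z) ∂D =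
      1 - (1 - exp (-1)) * D.real s := by
    rw [integral_sub (integrable_const _) (hind.const_mul _), integral_const_mul,
      integral_indicator_const _ hs]
    simp
  rw [integral_congr_ae (Filter.Eventually.of_forall hpoint), hone]
  linarith [add_one_le_exp (-((1 - exp (-1)) * D.real s))]

/-- For a fixed hypothesis the sample errors are independent Bernoulli variables, so the
exponential moment factorizes. -/
lemma lintegral_exp_pacExponent_le_one (herr : MeasurableSet err) (h : H) :
    ∫⁻ S : Fin m → Z, ENNReal.ofReal (exp (pacExponent err D S h))
      ∂(Measure.pi fun _ => D) ≤ 1 := by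
  have hmeas := (measurable_pacExponent (D := D) (m := m) herr).comp
    (measurable_prodMk_right (y := h))
  have hint : Integrable (fun S : Fin m → Z => exp (pacExponent err D S h))
      (Measure.pi fun _ => D) := by
    refine Integrable.of_bound hmeas.exp.aestronglyMeasurable (exp m)
      (Filter.Eventually.of_forall fun S => ?_)
    rw [norm_of_nonneg (exp_pos _).le]
    exact exp_le_exp.2 (abs_le.1 (abs_pacExponent_le S h)).2
  rw [← ofReal_integral_eq_lintegral_ofReal hint
    (Filter.Eventually.of_forall fun _ => (exp_pos _).le), ENNReal.ofReal_le_one]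
  have hprod : ∀ S : Fin m → Z, exp (pacExponent err D S h) =
      exp (m * ((1 - exp (-1)) * D.real {z | (h, z) ∈ err})) *
        ∏ i, exp (-({z | (h, z) ∈ err}.indicator (fun _ => (1 : ℝ)) (S i))) := by
    intro S
    rw [pacExponent, sub_eq_add_neg, exp_add, errorCount, ← Finset.sum_neg_distrib, exp_sum]
    simp only [indicator_prodMk_left]
  have hsec : MeasurableSet {z | (h, z) ∈ err} := measurable_prodMk_left herr
  have hle := integral_exp_neg_indicator_le (D := D) hsec
  have hpi := integral_fintype_prod_eq_prod (μ := fun _ : Fin m => D)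
    (fun _ z => exp (-({z | (h, z) ∈ err}.indicator (fun _ => (1 : ℝ)) z)))
  rw [integral_congr_ae (Filter.Eventually.of_forall hprod), integral_const_mul, hpi,
    Finset.prod_const, Finset.card_univ, Fintype.card_fin]
  refine (mul_le_mul_of_nonneg_left (pow_le_pow_left₀
    (integral_nonneg fun z => (exp_pos _).le) hle m) (exp_pos _).le).trans ?_
  rw [← exp_nat_mul, ← exp_add, mul_neg, add_neg_cancel, exp_zero]

lemma measurableSet_pacGood (herr : MeasurableSet err) (δ : ℝ) :
    MeasurableSet (pacGood err D P m δ) :=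
  measurableSet_le (Measurable.lintegral_prod_right' (f := fun q : (Fin m → Z) × H =>
    ENNReal.ofReal (exp (pacExponent err D q.1 q.2)))
    (measurable_pacExponent herr).exp.ennreal_ofReal) measurable_const

lemma le_measure_pacGood (herr : MeasurableSet err) {δ : ℝ} (hδ : 0 < δ) :
    1 - δ ≤ (Measure.pi fun _ : Fin m => D).real (pacGood err D P m δ) := by
  set μ := Measure.pi fun _ : Fin m => D
  have hme : Measurable fun q : (Fin m → Z) × H =>
      ENNReal.ofReal (exp (pacExponent err D q.1 q.2)) :=
    (measurable_pacExponent herr).exp.ennreal_ofReal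
  have htot : ∫⁻ S, ∫⁻ h, ENNReal.ofReal (exp (pacExponent err D S h)) ∂P ∂μ ≤ 1 := by
    rw [lintegral_lintegral_swap hme.aemeasurable]
    calc _ ≤ ∫⁻ _ : H, 1 ∂P := lintegral_mono fun h => lintegral_exp_pacExponent_le_one herr h
      _ = 1 := by simp
  have hmk := (mul_meas_ge_le_lintegral (μ := μ) hme.lintegral_prod_right'
    (ENNReal.ofReal (1 / δ))).trans htot
  have hsub : (pacGood err D P m δ)ᶜ ⊆ {S | ENNReal.ofReal (1 / δ) ≤
      ∫⁻ h, ENNReal.ofReal (exp (pacExponent err D S h)) ∂P} := fun S hS => by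
    simp only [pacGood, Set.mem_compl_iff, Set.mem_ofPred_eq, not_le] at hS
    exact hS.le
  have h1 := (mul_le_mul_right (measure_mono hsub) _).trans hmk
  have h2 := ENNReal.toReal_mono ENNReal.one_ne_top h1
  rw [ENNReal.toReal_mul, ENNReal.toReal_ofReal (by positivity), ENNReal.toReal_one] at h2
  have h3 : μ.real (pacGood err D P m δ)ᶜ ≤ δ := by
    rw [one_div, inv_mul_le_iff₀ hδ, mul_one] at h2
    exact h2
  rw [probReal_compl_eq_one_sub (measurableSet_pacGood herr δ)] at h3
  linarith

end PacBayes

section GaussianPacBayes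

variable {E Z : Type*} [NormedAddCommGroup E] [InnerProductSpace ℝ E] [FiniteDimensional ℝ E]
  [MeasurableSpace E] [BorelSpace E] [MeasurableSpace Z]
  {err : Set (E × Z)} {D : Measure Z} [IsProbabilityMeasure D] {m : ℕ}

/-- On a good sample, the PAC-Bayes bound holds simultaneously for the Gaussian perturbations of all
hypotheses `v`. -/
lemma integral_error_le_of_mem_pacGood (herr : MeasurableSet err) {δ : ℝ} (hδ : 0 < δ)
    {S : Fin m → Z} (hS : S ∈ pacGood err D (gaussianMeasure E) m δ) (v : E) :
    m * ((1 - exp (-1)) * ∫ g, D.real {z | (g + v, z) ∈ err} ∂gaussianMeasure E) ≤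
      ∑ i, (gaussianMeasure E).real {g | (g + v, S i) ∈ err} + ‖v‖ ^ 2 / 2 + log (1 / δ) := by
  have hmeas := (measurable_pacExponent (D := D) herr).comp (measurable_prodMk_left (x := S))
  have hmain := integral_shift_le_of_lintegral_exp_le (fun h => pacExponent err D S h) hmeas
    (fun g => abs_pacExponent_le S g) v (one_div_pos.2 hδ) hS
  have hsec : ∀ i, MeasurableSet {g : E | (g + v, S i) ∈ err} := fun i =>
    (by fun_prop : Measurable fun g : E => (g + v, S i)) herr
  have hint1 : Integrable (fun g => D.real {z | (g + v, z) ∈ err}) (gaussianMeasure E) :=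
    Integrable.of_bound ((measurable_real_section herr).comp
      (measurable_add_const v)).aestronglyMeasurable 1 (Filter.Eventually.of_forall fun g => by
        rw [norm_of_nonneg measureReal_nonneg]; exact measureReal_le_one)
  have hint2 : ∀ i, Integrable (fun g => err.indicator (fun _ => (1 : ℝ)) (g + v, S i))
      (gaussianMeasure E) := fun i => (integrable_const (1 : ℝ)).indicator (hsec i)
  have hint3 : Integrable (fun g => errorCount err S (g + v)) (gaussianMeasure E) :=
    integrable_finsetSum _ fun i _ => hint2 i
  have heq : ∫ g, errorCount err S (g + v) ∂gaussianMeasure E =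
      ∑ i, (gaussianMeasure E).real {g | (g + v, S i) ∈ err} := by
    unfold errorCount
    rw [integral_finsetSum _ fun i _ => hint2 i]
    refine Finset.sum_congr rfl fun i _ => ?_
    have := integral_indicator_const (μ := gaussianMeasure E) (1 : ℝ) (hsec i)
    rw [smul_eq_mul, mul_one] at this
    exact this
  simp only [pacExponent] at hmain
  rw [integral_sub ((hint1.const_mul _).const_mul _) hint3, integral_const_mul,
    integral_const_mul, heq] at hmain
  linarith

end GaussianPacBayes

/-! ### Gradient flow on the exponential loss -/

section Flow

variable {d m : ℕ} {S : Fin m → EuclideanSpace ℝ (Fin d) × ℝ} {γ : ℝ}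
  {w₀ : EuclideanSpace ℝ (Fin d)} {w : ℝ → EuclideanSpace ℝ (Fin d)}

local notation "risk" => empiricalRisk expLoss

lemma hasGradientAt_empiricalRisk (S : Fin m → EuclideanSpace ℝ (Fin d) × ℝ)
    (w : EuclideanSpace ℝ (Fin d)) :
    HasGradientAt (risk S)
      ((1 / (m : ℝ)) • ∑ i, (-(exp (-((S i).2 * inner ℝ (S i).1 w)) * (S i).2)) • (S i).1) w := by
  rw [hasGradientAt_iff_hasFDerivAt]
  unfold empiricalRisk expLoss
  have h : ∀ i, HasFDerivAt
      (fun w : EuclideanSpace ℝ (Fin d) => exp (-((S i).2 * inner ℝ (S i).1 w)))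
      (exp (-((S i).2 * inner ℝ (S i).1 w)) • -((S i).2 • innerSL ℝ (S i).1)) w := fun i =>
    (((innerSL ℝ (S i).1).hasFDerivAt.const_mul (S i).2).neg).exp
  refine ((HasFDerivAt.fun_sum fun i _ => h i).const_mul (1 / (m : ℝ))).congr_fderiv ?_
  ext v
  simp [mul_assoc]

lemma inner_gradient_empiricalRisk (S : Fin m → EuclideanSpace ℝ (Fin d) × ℝ)
    (w v : EuclideanSpace ℝ (Fin d)) :
    inner ℝ (gradient (risk S) w) v =
      -((1 / (m : ℝ)) * ∑ i, exp (-((S i).2 * inner ℝ (S i).1 w)) *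
        ((S i).2 * inner ℝ (S i).1 v)) := by
  rw [(hasGradientAt_empiricalRisk S w).gradient, real_inner_smul_left, sum_inner, ← mul_neg,
    ← Finset.sum_neg_distrib]
  congr 1
  refine Finset.sum_congr rfl fun i _ => ?_
  rw [real_inner_smul_left]
  ring

/-- The first-order convexity inequality for the empirical risk. -/
lemma empiricalRisk_sub_le_inner_gradient (S : Fin m → EuclideanSpace ℝ (Fin d) × ℝ)
    (w u : EuclideanSpace ℝ (Fin d)) :
    risk S w - risk S u ≤ inner ℝ (gradient (risk S) w) (w - u) := by
  rw [inner_gradient_empiricalRisk]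
  unfold empiricalRisk expLoss
  rw [← mul_sub, ← Finset.sum_sub_distrib, ← mul_neg, ← Finset.sum_neg_distrib]
  refine mul_le_mul_of_nonneg_left (Finset.sum_le_sum fun i _ => ?_) (by positivity)
  rw [inner_sub_right]
  set a := (S i).2 * inner ℝ (S i).1 w
  set b := (S i).2 * inner ℝ (S i).1 u with hb
  have h1 : exp (-b) = exp (-a) * exp (a - b) := by rw [← exp_add]; ring_nf
  have h2 := mul_le_mul_of_nonneg_left (add_one_le_exp (a - b)) (exp_pos (-a)).le
  rw [mul_sub, h1]
  linarith

lemma inner_gradient_le_neg_margin_mul (hS : ∀ i, γ ≤ (S i).2 * inner ℝ (S i).1 w₀)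
    (w : EuclideanSpace ℝ (Fin d)) :
    inner ℝ (gradient (risk S) w) w₀ ≤ -(γ * risk S w) := by
  rw [inner_gradient_empiricalRisk]
  unfold empiricalRisk expLoss
  rw [mul_left_comm, Finset.mul_sum Finset.univ _ γ]
  have h : ∀ i ∈ Finset.univ, γ * exp (-((S i).2 * inner ℝ (S i).1 w)) ≤
      exp (-((S i).2 * inner ℝ (S i).1 w)) * ((S i).2 * inner ℝ (S i).1 w₀) := fun i _ => by
    rw [mul_comm]
    exact mul_le_mul_of_nonneg_left (hS i) (exp_pos _).le
  have hm : 0 ≤ 1 / (m : ℝ) := by positivity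
  exact neg_le_neg (mul_le_mul_of_nonneg_left (Finset.sum_le_sum h) hm)

lemma empiricalRisk_pos (hm : 1 ≤ m) (S : Fin m → EuclideanSpace ℝ (Fin d) × ℝ)
    (w : EuclideanSpace ℝ (Fin d)) : 0 < risk S w := by
  have : Nonempty (Fin m) := ⟨⟨0, hm⟩⟩
  unfold empiricalRisk expLoss
  have : (0 : ℝ) < m := by exact_mod_cast hm
  exact mul_pos (by positivity)
    (Finset.sum_pos (fun i _ => exp_pos _) Finset.univ_nonempty)

lemma empiricalRisk_zero (hm : 1 ≤ m) (S : Fin m → EuclideanSpace ℝ (Fin d) × ℝ) :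
    risk S 0 = 1 := by
  have : (m : ℝ) ≠ 0 := by positivity
  simp [empiricalRisk, expLoss, this]

lemma empiricalRisk_smul_le (hm : 1 ≤ m) (hS : ∀ i, γ ≤ (S i).2 * inner ℝ (S i).1 w₀) {a : ℝ}
    (ha : 0 ≤ a) : risk S (a • w₀) ≤ exp (-(a * γ)) := by
  have hm' : (0 : ℝ) < m := by exact_mod_cast hm
  unfold empiricalRisk expLoss
  rw [one_div, inv_mul_le_iff₀ hm']
  refine (Finset.sum_le_card_nsmul _ _ (exp (-(a * γ))) fun i _ => ?_).trans (by simp)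
  rw [inner_smul_right]
  refine exp_le_exp.2 (neg_le_neg ?_)
  nlinarith [hS i]

/-- The chain rule along a gradient flow: the risk decreases at the rate `‖∇L‖²`. -/
lemma IsGradientFlow.hasDerivWithinAt_risk (hw : IsGradientFlow (risk S) w) {t : ℝ} (ht : 0 ≤ t) :
    HasDerivWithinAt (fun t => risk S (w t)) (-‖gradient (risk S) (w t)‖ ^ 2) (Set.Ici 0) t := by
  have hL := (hasGradientAt_empiricalRisk S (w t)).differentiableAt.hasGradientAt.hasFDerivAt
  refine (hL.comp_hasDerivWithinAt t (hw.deriv t ht)).congr_deriv ?_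
  rw [map_neg, InnerProductSpace.toDual_apply_apply, real_inner_self_eq_norm_sq]

lemma antitoneOn_Ici_of_hasDerivWithinAt_nonpos {f f' : ℝ → ℝ}
    (hf : ∀ t, 0 ≤ t → HasDerivWithinAt f (f' t) (Set.Ici 0) t) (hf' : ∀ t, 0 ≤ t → f' t ≤ 0) :
    AntitoneOn f (Set.Ici 0) := by
  refine antitoneOn_of_hasDerivWithinAt_nonpos (f' := f') (convex_Ici 0)
    (fun t ht => (hf t ht).continuousWithinAt) (fun t ht => ?_) (fun t ht => ?_)
  · exact (hf t (interior_subset ht)).mono interior_subset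
  · exact hf' t (interior_subset ht)

/-- Convergence rate of the risk. The potential `t L(w t) + ‖w t - u‖² / 2 - t L(u)` is
nonincreasing by convexity; take `u = a • w₀`. -/
lemma IsGradientFlow.risk_le (hw : IsGradientFlow (risk S) w) (hm : 1 ≤ m) (hw₀ : ‖w₀‖ = 1)
    (hS : ∀ i, γ ≤ (S i).2 * inner ℝ (S i).1 w₀) {a : ℝ} (ha : 0 ≤ a) {T : ℝ} (hT : 0 < T) :
    risk S (w T) ≤ exp (-(a * γ)) + a ^ 2 / (2 * T) := by
  set u := a • w₀
  have hderiv : ∀ t, 0 ≤ t → HasDerivWithinAt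
      (fun t => t * risk S (w t) + ‖w t - u‖ ^ 2 / 2 - t * risk S u)
      ((1 * risk S (w t) + t * -‖gradient (risk S) (w t)‖ ^ 2) +
        2 * inner ℝ (w t - u) (-gradient (risk S) (w t)) / 2 - 1 * risk S u) (Set.Ici 0) t :=
    fun t ht => (((hasDerivWithinAt_id t _).mul (hw.hasDerivWithinAt_risk ht)).add
      ((((hw.deriv t ht).sub_const u).norm_sq).div_const 2)).sub
        ((hasDerivWithinAt_id t _).mul_const _)
  have hanti := antitoneOn_Ici_of_hasDerivWithinAt_nonpos hderiv fun t ht => by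
    have h1 := empiricalRisk_sub_le_inner_gradient S (w t) u
    rw [real_inner_comm] at h1
    rw [inner_neg_right]
    nlinarith [mul_nonneg ht (sq_nonneg ‖gradient (risk S) (w t)‖)]
  have h := hanti Set.self_mem_Ici hT.le hT.le
  have hu : ‖u‖ ^ 2 = a ^ 2 := by simp [u, norm_smul, hw₀]
  simp only [hw.init, zero_sub, norm_neg, hu, zero_mul, zero_add, sub_zero] at h
  have h2 := empiricalRisk_smul_le hm hS ha
  have h3 : T * risk S (w T) ≤ T * (exp (-(a * γ)) + a ^ 2 / (2 * T)) := by
    have : T * (a ^ 2 / (2 * T)) = a ^ 2 / 2 := by field_simp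
    nlinarith [sq_nonneg ‖w T - u‖]
  exact le_of_mul_le_mul_left h3 hT

/-- The smoothed margin `-log L(w T)` is at least `γ ‖w T‖`: since `‖∇L‖ ≥ γ L`, the quantity
`log L(w t) + γ ⟪w t, e⟫` is nonincreasing for each unit vector `e`. -/
lemma IsGradientFlow.risk_le_exp_neg_norm (hw : IsGradientFlow (risk S) w) (hm : 1 ≤ m)
    (hγ : 0 ≤ γ)
    (hw₀ : ‖w₀‖ = 1) (hS : ∀ i, γ ≤ (S i).2 * inner ℝ (S i).1 w₀) {T : ℝ} (hT : 0 ≤ T) :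
    risk S (w T) ≤ exp (-(γ * ‖w T‖)) := by
  obtain ⟨e, he, hinner⟩ : ∃ e : EuclideanSpace ℝ (Fin d), ‖e‖ = 1 ∧ inner ℝ (w T) e = ‖w T‖ := by
    by_cases h : w T = 0
    · exact ⟨w₀, hw₀, by simp [h]⟩
    · have hn : ‖w T‖ ≠ 0 := norm_ne_zero_iff.2 h
      refine ⟨‖w T‖⁻¹ • w T, by simp [norm_smul, hn], ?_⟩
      rw [inner_smul_right, real_inner_self_eq_norm_sq]
      field_simp
  have hderiv : ∀ t, 0 ≤ t → HasDerivWithinAt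
      (fun t => log (risk S (w t)) + γ * inner ℝ (w t) e)
      (-‖gradient (risk S) (w t)‖ ^ 2 / risk S (w t) +
        γ * inner ℝ (-gradient (risk S) (w t)) e) (Set.Ici 0) t := fun t ht => by
    have h1 := (hw.hasDerivWithinAt_risk ht).log (empiricalRisk_pos hm S (w t)).ne'
    have h2 := ((hw.deriv t ht).inner ℝ (hasDerivWithinAt_const t (Set.Ici 0) e)).const_mul γ
    simp only [inner_zero_right, zero_add] at h2
    exact h1.add h2
  have hanti := antitoneOn_Ici_of_hasDerivWithinAt_nonpos hderiv fun t ht => by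
    have hL := empiricalRisk_pos hm S (w t)
    set G := gradient (risk S) (w t) with hG
    have h1 : γ * risk S (w t) ≤ ‖G‖ := by
      have := inner_gradient_le_neg_margin_mul hS (w t)
      have h3 := neg_le_of_abs_le (abs_real_inner_le_norm G w₀)
      rw [hw₀, mul_one] at h3
      linarith
    have h2 : inner ℝ (-G) e ≤ ‖G‖ := by
      have := real_inner_le_norm (-G) e
      rwa [norm_neg, he, mul_one] at this
    rw [neg_div, neg_add_nonpos_iff, le_div_iff₀ hL]
    calc γ * inner ℝ (-G) e * risk S (w t) = γ * risk S (w t) * inner ℝ (-G) e := by ring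
      _ ≤ γ * risk S (w t) * ‖G‖ := mul_le_mul_of_nonneg_left h2 (by positivity)
      _ ≤ ‖G‖ * ‖G‖ := mul_le_mul_of_nonneg_right h1 (norm_nonneg G)
      _ = ‖G‖ ^ 2 := by ring
  have h := hanti Set.self_mem_Ici hT hT
  simp only [hw.init, empiricalRisk_zero hm, log_one, inner_zero_left, mul_zero, add_zero,
    hinner] at h
  rw [← log_le_iff_le_exp (empiricalRisk_pos hm S _)]
  linarith

/-- Markov's inequality for the loss: the number of points with margin less than `θ`. -/
lemma card_margin_lt_le (hm : 1 ≤ m) (S : Fin m → EuclideanSpace ℝ (Fin d) × ℝ)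
    (w : EuclideanSpace ℝ (Fin d)) (θ : ℝ) :
    (∑ i, if (S i).2 * inner ℝ (S i).1 w < θ then (1 : ℝ) else 0) ≤ m * (exp θ * risk S w) := by
  have hm' : (m : ℝ) ≠ 0 := by positivity
  have : m * (exp θ * risk S w) = ∑ i, exp (θ - (S i).2 * inner ℝ (S i).1 w) := by
    unfold empiricalRisk expLoss
    simp only [sub_eq_add_neg, exp_add, ← Finset.mul_sum]
    field_simp
  rw [this]
  refine Finset.sum_le_sum fun i _ => ?_
  split_ifs with h
  · exact one_le_exp (by linarith)
  · positivity

end Flow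

/-! ### Margin bound for linear classifiers -/

section Margin

variable {d m : ℕ} {D : Measure (EuclideanSpace ℝ (Fin d) × ℝ)}

/-- The pairs of a linear predictor `h` and a labelled point `(x, y)` with `y ⟪x, h⟫ ≤ 0`. -/
def marginErr (d : ℕ) :
    Set (EuclideanSpace ℝ (Fin d) × (EuclideanSpace ℝ (Fin d) × ℝ)) :=
  {q | q.2.2 * inner ℝ q.2.1 q.1 ≤ 0}

lemma measurableSet_marginErr : MeasurableSet (marginErr d) :=
  measurableSet_le (by fun_prop) measurable_const

lemma zeroOneError_le_marginErr [IsProbabilityMeasure D]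
    (hD : ∀ᵐ z ∂D, ‖z.1‖ ≤ 1 ∧ (z.2 = -1 ∨ z.2 = 1))
    (w : EuclideanSpace ℝ (Fin d)) :
    zeroOneError D w ≤ D.real {z | (w, z) ∈ marginErr d} := by
  refine ENNReal.toReal_mono (measure_ne_top _ _) (measure_mono_ae ?_)
  filter_upwards [hD] with z hz hne
  change z.2 * inner ℝ z.1 w ≤ 0
  change Real.sign (inner ℝ z.1 w) ≠ z.2 at hne
  by_contra! hpos
  rcases hz.2 with h | h
  · rw [h] at hpos hne
    exact hne (Real.sign_of_neg (by linarith))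
  · rw [h] at hpos hne
    exact hne (Real.sign_of_pos (by linarith))

/-- The Gaussian perturbation is symmetric, so a point misclassified by `v` is misclassified by the
perturbed predictor with probability at least one half. -/
lemma marginErr_le_two_mul_integral [IsProbabilityMeasure D] (v : EuclideanSpace ℝ (Fin d)) :
    D.real {z | (v, z) ∈ marginErr d} ≤ 2 * ∫ g, D.real {z | (g + v, z) ∈ marginErr d}
      ∂gaussianMeasure (EuclideanSpace ℝ (Fin d)) := by
  set P := gaussianMeasure (EuclideanSpace ℝ (Fin d)) with hP
  set W : Set (EuclideanSpace ℝ (Fin d) × (EuclideanSpace ℝ (Fin d) × ℝ)) :=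
    {q | q.2.2 * inner ℝ q.2.1 (q.1 + v) ≤ 0} with hW
  have hWm : MeasurableSet W := measurableSet_le (by fun_prop) measurable_const
  have hBm : MeasurableSet {z | (v, z) ∈ marginErr d} :=
    measurable_prodMk_left measurableSet_marginErr
  have h1 : ∫ g, D.real {z | (g + v, z) ∈ marginErr d} ∂P = ((P.prod D) W).toReal := by
    rw [Measure.prod_apply hWm, ← integral_toReal
      (measurable_measure_prodMk_left hWm).aemeasurable
      (Filter.Eventually.of_forall fun _ => measure_lt_top _ _)]
    rfl
  have h2 : ENNReal.ofReal (1 / 2) * D {z | (v, z) ∈ marginErr d} ≤ (P.prod D) W := by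
    rw [Measure.prod_apply_symm hWm, ← lintegral_indicator_const hBm]
    refine lintegral_mono fun z => ?_
    by_cases hz : z ∈ {z | (v, z) ∈ marginErr d}
    · rw [Set.indicator_of_mem hz]
      refine ENNReal.ofReal_le_of_le_toReal ?_
      refine (half_le_gaussianMeasure_inner_nonpos (z.2 • z.1)).trans ?_
      refine measureReal_mono (fun g hg => ?_)
      change z.2 * inner ℝ z.1 v ≤ 0 at hz
      change inner ℝ (z.2 • z.1) g ≤ 0 at hg
      change z.2 * inner ℝ z.1 (g + v) ≤ 0
      rw [real_inner_smul_left] at hg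
      rw [inner_add_right]
      linarith
    · rw [Set.indicator_of_notMem hz]
      exact zero_le
  have h3 := ENNReal.toReal_mono (measure_ne_top _ _) h2
  rw [ENNReal.toReal_mul, ENNReal.toReal_ofReal (by norm_num), ← h1] at h3
  change 1 / 2 * D.real _ ≤ _ at h3
  linarith

/-- A point with margin at least `s` under `v` is misclassified by the perturbed predictor only if
the perturbation exceeds `s` in the direction of the point. -/
lemma gaussianMeasure_marginErr_le (v : EuclideanSpace ℝ (Fin d))
    {z : EuclideanSpace ℝ (Fin d) × ℝ} (hz : ‖z.1‖ ≤ 1 ∧ (z.2 = -1 ∨ z.2 = 1)) {s : ℝ}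
    (hs : 0 ≤ s) :
    (gaussianMeasure (EuclideanSpace ℝ (Fin d))).real {g | (g + v, z) ∈ marginErr d} ≤
      (if z.2 * inner ℝ z.1 v < s then 1 else 0) + exp (-(s ^ 2 / 2)) := by
  split_ifs with h
  · exact measureReal_le_one.trans (by linarith [exp_pos (-(s ^ 2 / 2))])
  · rw [zero_add]
    have hn : ‖-(z.2 • z.1)‖ ≤ 1 := by
      rw [norm_neg, norm_smul]
      rcases hz.2 with h | h <;> simp [h, hz.1]
    refine (measureReal_mono fun g hg => ?_).trans (gaussianMeasure_real_le_inner _ hn hs)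
    change z.2 * inner ℝ z.1 (g + v) ≤ 0 at hg
    change s ≤ inner ℝ (-(z.2 • z.1)) g
    rw [inner_add_right] at hg
    rw [inner_neg_left, real_inner_smul_left]
    linarith

/-- The margin bound: on a good sample, the error of each linear predictor `w` is controlled by its
empirical exponential loss. The free parameters are the margin threshold `θ` and the scale `β` of
the predictor relative to the Gaussian perturbation. -/
lemma zeroOneError_le_of_mem_pacGood [IsProbabilityMeasure D]
    (hD : ∀ᵐ z ∂D, ‖z.1‖ ≤ 1 ∧ (z.2 = -1 ∨ z.2 = 1)) (hm : 1 ≤ m) {δ : ℝ} (hδ : 0 < δ)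
    {S : Fin m → EuclideanSpace ℝ (Fin d) × ℝ}
    (hS : S ∈ pacGood (marginErr d) D (gaussianMeasure _) m δ)
    (hSb : ∀ i, ‖(S i).1‖ ≤ 1 ∧ ((S i).2 = -1 ∨ (S i).2 = 1))
    (w : EuclideanSpace ℝ (Fin d)) {β θ : ℝ} (hβ : 0 < β) (hθ : 0 ≤ θ) :
    zeroOneError D w ≤ 4 * (exp θ * empiricalRisk expLoss S w + exp (-((β * θ) ^ 2 / 2)) +
      ((β * ‖w‖) ^ 2 / 2 + log (1 / δ)) / m) := by
  have hm' : (0 : ℝ) < m := by exact_mod_cast hm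
  have h1 := integral_error_le_of_mem_pacGood measurableSet_marginErr hδ hS (β • w)
  have h2 := marginErr_le_two_mul_integral (D := D) (β • w)
  have hscale : {z | (β • w, z) ∈ marginErr d} = {z | (w, z) ∈ marginErr d} := by
    ext z
    change z.2 * inner ℝ z.1 (β • w) ≤ 0 ↔ z.2 * inner ℝ z.1 w ≤ 0
    rw [inner_smul_right, mul_left_comm]
    exact ⟨fun h => not_lt.1 fun h' => (mul_pos hβ h').not_ge h,
      fun h => mul_nonpos_of_nonneg_of_nonpos hβ.le h⟩
  rw [hscale] at h2
  have h0 := zeroOneError_le_marginErr hD w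
  have h3 : ∑ i, (gaussianMeasure (EuclideanSpace ℝ (Fin d))).real
      {g | (g + β • w, S i) ∈ marginErr d} ≤
      m * (exp θ * empiricalRisk expLoss S w) + m * exp (-((β * θ) ^ 2 / 2)) := by
    calc _ ≤ ∑ i, ((if (S i).2 * inner ℝ (S i).1 w < θ then (1 : ℝ) else 0) +
            exp (-((β * θ) ^ 2 / 2))) := by
          refine Finset.sum_le_sum fun i _ => ?_
          refine (gaussianMeasure_marginErr_le (β • w) (hSb i) (by positivity : 0 ≤ β * θ)).trans
            (le_of_eq ?_)
          simp only [inner_smul_right, mul_left_comm, mul_lt_mul_iff_right₀ hβ]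
      _ ≤ _ := by
          rw [Finset.sum_add_distrib]
          refine add_le_add (card_margin_lt_le hm S w θ) (by simp)
  have hnorm : ‖β • w‖ = β * ‖w‖ := by rw [norm_smul, norm_of_nonneg hβ.le]
  rw [hnorm] at h1
  -- the discount factor `1 - e⁻¹` is at least one half
  have hc : 1 / 2 ≤ 1 - exp (-1) := by
    have : exp (-1) * exp 1 = 1 := by rw [← exp_add]; simp
    nlinarith [add_one_le_exp 1, exp_pos (-1)]
  set I := ∫ g, D.real {z | (g + β • w, z) ∈ marginErr d}
      ∂gaussianMeasure (EuclideanSpace ℝ (Fin d))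
  have hI : 0 ≤ I := integral_nonneg fun _ => measureReal_nonneg
  have h4 : m * (I / 2) ≤ m * ((1 - exp (-1)) * I) :=
    mul_le_mul_of_nonneg_left (by nlinarith) hm'.le
  have h5 : I / 2 ≤ exp θ * empiricalRisk expLoss S w + exp (-((β * θ) ^ 2 / 2)) +
      ((β * ‖w‖) ^ 2 / 2 + log (1 / δ)) / m := by
    refine le_of_mul_le_mul_left ?_ hm'
    rw [mul_add, mul_add, mul_div_cancel₀ _ hm'.ne']
    linarith
  linarith

end Margin

/-! ### The generalization error of gradient flow -/

section Main

variable {d m : ℕ} {D : Measure (EuclideanSpace ℝ (Fin d) × ℝ)}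

/-- The margin of data in the unit ball is at most one. -/
lemma margin_le_one [IsProbabilityMeasure D] {γ : ℝ} {w₀ : EuclideanSpace ℝ (Fin d)}
    (hD : ∀ᵐ z ∂D, ‖z.1‖ ≤ 1 ∧ (z.2 = -1 ∨ z.2 = 1)) (hw₀ : ‖w₀‖ = 1)
    (hγ : ∀ᵐ z ∂D, γ ≤ z.2 * inner ℝ z.1 w₀) : γ ≤ 1 := by
  obtain ⟨z, hz, hzγ⟩ := (hD.and hγ).exists
  have h1 := abs_real_inner_le_norm z.1 w₀
  rw [hw₀, mul_one] at h1
  have h2 := abs_le.1 (h1.trans hz.1)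
  rcases hz.2 with h | h <;> rw [h] at hzγ <;> linarith

/-- Choice of parameters in the margin bound, with `ℓ = log (γ² m)`. If `γ ‖w T‖ ≥ 2 ℓ`, the
normalized margin is at least `γ / 2` on all but a fraction `1 / (γ² m)` of the sample; otherwise
the norm is at most `2 ℓ / γ`, and the convergence rate of the risk bounds the number of points
with margin less than one. -/
lemma zeroOneError_gradientFlow_le [IsProbabilityMeasure D]
    (hD : ∀ᵐ z ∂D, ‖z.1‖ ≤ 1 ∧ (z.2 = -1 ∨ z.2 = 1)) (hm : 1 ≤ m) {δ γ : ℝ} (hδ : 0 < δ)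
    (hγ : 0 < γ) {w₀ : EuclideanSpace ℝ (Fin d)} (hw₀ : ‖w₀‖ = 1)
    {S : Fin m → EuclideanSpace ℝ (Fin d) × ℝ}
    (hS : S ∈ pacGood (marginErr d) D (gaussianMeasure _) m δ)
    (hSb : ∀ i, ‖(S i).1‖ ≤ 1 ∧ ((S i).2 = -1 ∨ (S i).2 = 1))
    (hSγ : ∀ i, γ ≤ (S i).2 * inner ℝ (S i).1 w₀)
    {w : ℝ → EuclideanSpace ℝ (Fin d)} (hw : IsGradientFlow (empiricalRisk expLoss S) w)
    {T : ℝ} (hT : 0 < T) (hℓ : 1 ≤ log (γ ^ 2 * m)) :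
    zeroOneError D (w T) ≤ 4 * (3 * (1 / (γ ^ 2 * m) + log (γ ^ 2 * m) ^ 2 / (2 * (γ ^ 2 * T))) +
      1 / (γ ^ 2 * m) + (4 * log (γ ^ 2 * m) ^ 3 / γ ^ 2 + log (1 / δ)) / m) := by
  have hm' : (0 : ℝ) < m := by exact_mod_cast hm
  set M := γ ^ 2 * (m : ℝ) with hM
  have hMpos : 0 < M := by positivity
  set ℓ := log M with hℓdef
  have hexpℓ : exp (-ℓ) = 1 / M := by rw [exp_neg, exp_log hMpos, one_div]
  set s := √(2 * ℓ) with hs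
  have hspos : 0 < s := sqrt_pos.2 (by linarith)
  have hs2 : s ^ 2 = 2 * ℓ := sq_sqrt (by linarith)
  have hexps : exp (-(s ^ 2 / 2)) = 1 / M := by
    rw [hs2, mul_div_cancel_left₀ _ two_ne_zero, hexpℓ]
  set n := ‖w T‖ with hn
  rcases le_or_gt (2 * ℓ) (γ * n) with hcase | hcase
  · have hγn : 0 < γ * n := by linarith
    have hn0 : 0 < n := pos_of_mul_pos_right hγn hγ.le
    -- the scale `β` turns the margin `θ` into `s`, for which the Gaussian tail is `1 / M`
    have hb := zeroOneError_le_of_mem_pacGood hD hm hδ hS hSb (w T)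
      (β := 2 * s / (γ * n)) (θ := γ * n / 2) (by positivity) (by positivity)
    have e1 : 2 * s / (γ * n) * (γ * n / 2) = s := by field_simp
    have e2 : (2 * s / (γ * n) * n) ^ 2 / 2 = 4 * ℓ / γ ^ 2 := by
      have : 2 * s / (γ * n) * n = 2 * s / γ := by field_simp
      rw [this, div_pow, mul_pow, hs2]
      ring
    rw [← hn, e1, e2, hexps] at hb
    have h1 : exp (γ * n / 2) * empiricalRisk expLoss S (w T) ≤ 1 / M := by
      calc _ ≤ exp (γ * n / 2) * exp (-(γ * n)) := mul_le_mul_of_nonneg_left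
            (hw.risk_le_exp_neg_norm hm hγ.le hw₀ hSγ hT.le) (exp_pos _).le
        _ ≤ exp (-ℓ) := by rw [← exp_add]; exact exp_le_exp.2 (by linarith)
        _ = 1 / M := hexpℓ
    have h2 : (4 * ℓ / γ ^ 2 + log (1 / δ)) / m ≤ (4 * ℓ ^ 3 / γ ^ 2 + log (1 / δ)) / m := by
      gcongr
      exact le_self_pow₀ hℓ (by norm_num)
    have h3 : 0 ≤ 1 / M := by positivity
    have h4 : 0 ≤ ℓ ^ 2 / (2 * (γ ^ 2 * T)) := by positivity
    linarith
  · have hb := zeroOneError_le_of_mem_pacGood hD hm hδ hS hSb (w T)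
      (β := s) (θ := 1) hspos zero_le_one
    rw [← hn, mul_one, hexps] at hb
    have h1 := hw.risk_le hm hw₀ hSγ (a := ℓ / γ) (by positivity) hT
    have e1 : ℓ / γ * γ = ℓ := by field_simp
    have e2 : (ℓ / γ) ^ 2 / (2 * T) = ℓ ^ 2 / (2 * (γ ^ 2 * T)) := by field_simp
    rw [e1, e2, hexpℓ] at h1
    have h2 : exp 1 * empiricalRisk expLoss S (w T) ≤
        3 * (1 / M + ℓ ^ 2 / (2 * (γ ^ 2 * T))) :=
      mul_le_mul (by linarith [exp_one_lt_d9]) h1 (empiricalRisk_pos hm S _).le (by norm_num)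
    have h3 : (s * n) ^ 2 / 2 ≤ 4 * ℓ ^ 3 / γ ^ 2 := by
      rw [mul_pow, hs2, le_div_iff₀ (by positivity)]
      have : (γ * n) ^ 2 ≤ (2 * ℓ) ^ 2 := pow_le_pow_left₀ (by positivity) hcase.le 2
      nlinarith
    have h4 : ((s * n) ^ 2 / 2 + log (1 / δ)) / m ≤ (4 * ℓ ^ 3 / γ ^ 2 + log (1 / δ)) / m := by
      gcongr
    linarith

/-- Absorbing the logarithms into a power of a single polylogarithmic factor. -/
lemma polylog_bound {M N γ m ℓ lam : ℝ} (hm : 0 < m) (hγ : 0 < γ) (hγ1 : γ ≤ 1)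
    (hM : M = γ ^ 2 * m) (hN : 0 < N) (hℓ : 1 ≤ ℓ) (hlam : 0 ≤ lam) :
    4 * (3 * (1 / M + ℓ ^ 2 / (2 * N)) + 1 / M + (4 * ℓ ^ 3 / γ ^ 2 + lam) / m) ≤
      36 * (1 + ℓ + lam) ^ 3 * (1 / N + 1 / M) := by
  have hMpos : 0 < M := by rw [hM]; positivity
  have h1 : (4 * ℓ ^ 3 / γ ^ 2 + lam) / m ≤ (4 * ℓ ^ 3 + lam) * (1 / M) := by
    rw [add_div, add_mul]
    refine add_le_add (le_of_eq ?_) ?_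
    · rw [hM]; field_simp
    · rw [mul_one_div]
      gcongr
      rw [hM]
      exact mul_le_of_le_one_left hm.le (pow_le_one₀ hγ.le hγ1)
  have h2 : ℓ ^ 2 / (2 * N) = ℓ ^ 2 / 2 * (1 / N) := by field_simp
  set B := 1 + ℓ + lam with hB
  have hB1 : 1 ≤ B := by linarith
  have hBB : B ≤ B ^ 3 := le_self_pow₀ hB1 (by norm_num)
  have hℓ3 : ℓ ^ 3 ≤ B ^ 3 := pow_le_pow_left₀ (by linarith) (by linarith) 3
  have hℓ2 : ℓ ^ 2 ≤ B ^ 3 := (pow_le_pow_right₀ hℓ (by norm_num : 2 ≤ 3)).trans hℓ3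
  have h3 : (4 + (4 * ℓ ^ 3 + lam)) * (1 / M) ≤ 9 * B ^ 3 * (1 / M) :=
    mul_le_mul_of_nonneg_right (by linarith) (by positivity)
  have h4 : 3 * (ℓ ^ 2 / 2) * (1 / N) ≤ 9 * B ^ 3 * (1 / N) :=
    mul_le_mul_of_nonneg_right (by linarith) (by positivity)
  rw [h2]
  linarith

end Main

theorem mainTheorem1 :
    ∃ (C : ℝ) (k : ℕ), 0 < C ∧
      ∀ (d m : ℕ) (D : Measure (EuclideanSpace ℝ (Fin d) × ℝ)) (γ δ : ℝ)
        (w₀ : EuclideanSpace ℝ (Fin d)),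
        IsProbabilityMeasure D →
        (∀ᵐ z ∂D, ‖z.1‖ ≤ 1 ∧ (z.2 = -1 ∨ z.2 = 1)) →
        0 < γ → ‖w₀‖ = 1 → (∀ᵐ z ∂D, γ ≤ z.2 * inner ℝ z.1 w₀) →
        1 ≤ m → 0 < δ → δ < 1 →
        ∃ A : Set (Fin m → EuclideanSpace ℝ (Fin d) × ℝ),
          MeasurableSet A ∧ 1 - δ ≤ (Measure.pi (fun _ : Fin m => D)).real A ∧
          ∀ S ∈ A, ∀ w : ℝ → EuclideanSpace ℝ (Fin d),
            IsGradientFlow (empiricalRisk expLoss S) w →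
            ∀ T : ℝ, 0 < T →
              zeroOneError D (w T) ≤
                C * (1 + max 0 (Real.log (γ ^ 2 * (m : ℝ))) + Real.log (1 / δ)) ^ k *
                  (1 / (γ ^ 2 * T) + 1 / (γ ^ 2 * (m : ℝ))) := by
  refine ⟨36, 3, by norm_num, ?_⟩
  intro d m D γ δ w₀ hprob hD hγ hw₀ hmargin hm hδ hδ1
  have hm' : (0 : ℝ) < m := by exact_mod_cast hm
  have hγ1 : γ ≤ 1 := margin_le_one hD hw₀ hmargin
  set good : Set (EuclideanSpace ℝ (Fin d) × ℝ) :=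
    {z | (‖z.1‖ ≤ 1 ∧ (z.2 = -1 ∨ z.2 = 1)) ∧ γ ≤ z.2 * inner ℝ z.1 w₀} with hgood
  have hgm : MeasurableSet good := by
    have h1 : MeasurableSet {z : EuclideanSpace ℝ (Fin d) × ℝ | ‖z.1‖ ≤ 1} :=
      measurableSet_le (by fun_prop) measurable_const
    have h2 : ∀ a : ℝ, MeasurableSet {z : EuclideanSpace ℝ (Fin d) × ℝ | z.2 = a} := fun a =>
      measurableSet_eq_fun (by fun_prop) measurable_const
    have h3 : MeasurableSet {z : EuclideanSpace ℝ (Fin d) × ℝ | γ ≤ z.2 * inner ℝ z.1 w₀} :=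
      measurableSet_le measurable_const (by fun_prop)
    exact (h1.inter ((h2 (-1)).union (h2 1))).inter h3
  have hae : ∀ᵐ S ∂(Measure.pi fun _ : Fin m => D), S ∈ Set.univ.pi fun _ : Fin m => good := by
    have : ∀ᵐ S ∂(Measure.pi fun _ : Fin m => D), ∀ i : Fin m, S i ∈ good :=
      ae_all_iff.2 fun i => (Measure.quasiMeasurePreserving_eval (μ := fun _ : Fin m => D)
        i).ae (hD.and hmargin)
    filter_upwards [this] with S hS i _ using hS i
  refine ⟨pacGood (marginErr d) D (gaussianMeasure _) m δ ∩ Set.univ.pi fun _ => good,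
    (measurableSet_pacGood measurableSet_marginErr δ).inter
      (MeasurableSet.univ_pi fun _ => hgm), ?_, ?_⟩
  · have hA := le_measure_pacGood (m := m) (D := D)
      (P := gaussianMeasure (EuclideanSpace ℝ (Fin d))) measurableSet_marginErr hδ
    refine hA.trans_eq (measureReal_congr ?_)
    filter_upwards [hae] with S hS
    exact propext ⟨fun h => ⟨h, hS⟩, fun h => h.1⟩
  · rintro S ⟨hS, hSgood⟩ w hw T hT
    have hSg : ∀ i, S i ∈ good := fun i => hSgood i (Set.mem_univ i)
    have hlam : 0 ≤ log (1 / δ) := log_nonneg (by rw [le_div_iff₀ hδ]; linarith)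
    have hN : 0 < γ ^ 2 * T := by positivity
    have hMpos : 0 < γ ^ 2 * (m : ℝ) := by positivity
    rcases le_or_gt 1 (log (γ ^ 2 * (m : ℝ))) with hℓ | hℓ
    · rw [max_eq_right (by linarith)]
      exact (zeroOneError_gradientFlow_le hD hm hδ hγ hw₀ hS (fun i => (hSg i).1)
        (fun i => (hSg i).2) hw hT hℓ).trans (polylog_bound hm' hγ hγ1 rfl hN hℓ hlam)
    · -- here `γ² m < e`, so the right-hand side exceeds one
      have hM3 : γ ^ 2 * (m : ℝ) ≤ 3 := by
        have := (log_lt_iff_lt_exp hMpos).1 hℓ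
        linarith [exp_one_lt_d9]
      have h1 : 1 / 3 ≤ 1 / (γ ^ 2 * T) + 1 / (γ ^ 2 * (m : ℝ)) := by
        have : 1 / 3 ≤ 1 / (γ ^ 2 * (m : ℝ)) := one_div_le_one_div_of_le hMpos hM3
        have : 0 ≤ 1 / (γ ^ 2 * T) := by positivity
        linarith
      have h2 : 1 ≤ (1 + max 0 (log (γ ^ 2 * (m : ℝ))) + log (1 / δ)) ^ 3 :=
        one_le_pow₀ (by linarith [le_max_left 0 (log (γ ^ 2 * (m : ℝ)))])
      have h3 : zeroOneError D (w T) ≤ 1 := measureReal_le_one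
      nlinarith
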